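/- Proposition. All Lie algebras are real, $e^{ij}=e^i\wedge e^j$, and brackets of basis vectors not listed (up to skew-symmetry) vanish. A symplectic Lie algebra $(\mathfrak g,\omega)$ is a Lie algebra with a non-degenerate alternating bilinear form satisfying $\omega([x,y],z)+\omega([y,z],x)+\omega([z,x],y)=0$; two are symplectomorphically isomorphic if there is a Lie algebra isomorphism carrying one form to the other. Let $\mathfrak g_{(1,0,0,1)}$ be the Lie algebra with basis $e_1,\dots,e_6$ and brackets $$[e_1,e_5]=e_2,\quad [e_2,e_5]=-e_1,\quad [e_3,e_6]=e_4,\quad [e_4,e_6]=-e_3 .$$ Let $\overline\omega$ be a symplectic form on $\overline{\mathfrak g}=\mathfrak g_{(1,0,0,1)}$. A generalized symplectic oxidation of $(\overline{\mathfrak g},\overline\omega)$ is a symplectic Lie algebra $(\mathfrak g,\omega)$ with a vector space decomposition $\mathfrak g=\mathbb R\ell\oplus\overline{\mathfrak g}\oplus\mathbb R\xi$ such that $\omega|_{\overline{\mathfrak g}\times\overline{\mathfrak g}}=\overline\omega$, $\omega(\ell,\overline{\mathfrak g})=\omega(\xi,\overline{\mathfrak g})=0$, $\omega(\ell,\xi)=1$,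 and such that for some endomorphism $D$ of $\overline{\mathfrak g}$, linear forms $\mu,\lambda$ on $\overline{\mathfrak g}$ and $t\in\mathbb R$, for all $x,y\in\overline{\mathfrak g}$, $$[x,y]=\overline{[x,y]}+\big(\overline\omega(Dx,y)+\overline\omega(x,Dy)\big)\xi,\quad [\xi,x]=-\mu(x)\xi,\quad [\xi,\ell]=t\xi,\quad [\ell,x]=\mu(x)\ell+D(x)+\lambda(x)\xi .$$ It is called central if $\xi$ is central in $\mathfrak g$, and normal if $(\mathbb R\xi)^{\perp_\omega}$ is an ideal of $\mathfrak g$. Let $(\mathfrak g,\omega)$ be an (eight-dimensional) generalized symplectic oxidation of $(\mathfrak g_{(1,0,0,1)},\overline\omega)$ that is neither central nor normal. Then $(\mathfrak g,\omega)$ is symplectomorphically isomorphic to a member of one of the following three families, each with basis $e_1,\dots,e_8$, the four brackets $[e_1,e_5]=e_2$, $[e_2,e_5]=-e_1$, $[e_3,e_6]=e_4$, $[e_4,e_6]=-e_3$, the symplectic form $e^{12}+e^{34}+\eta e^{56}+e^{78}$ with $\eta>0$, and the additional brackets - $\mathfrak g_{8,1}$: $[e_7,e_5]=-\mu_1e_7$,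 $[e_7,e_6]=-\mu_2e_7$, $[e_8,e_5]=\mu_1e_8$, $[e_8,e_6]=\mu_2e_8$, with $\mu_1,\mu_2\in\mathbb R\setminus\{0\}$; - $\mathfrak g_{8,2}$: $[e_7,e_5]=-\mu e_7$, $[e_8,e_5]=\mu e_8$, with $\mu\in\mathbb R\setminus\{0\}$; - $\mathfrak g_{8,3}$: $[e_7,e_6]=-\mu e_7$, $[e_8,e_6]=\mu e_8$, with $\mu\in\mathbb R\setminus\{0\}$. -/

import Mathlib

/-! Symplectic Lie algebras -/

/-- A symplectic form on a real Lie algebra: an alternating, non-degenerate, closed bilinear form. -/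
structure IsSymplecticForm {L : Type*} [LieRing L] [LieAlgebra ℝ L]
    (ω : L →ₗ[ℝ] L →ₗ[ℝ] ℝ) : Prop where
  alt : ∀ x, ω x x = 0
  nondegenerate : ω.Nondegenerate
  closed : ∀ x y z, ω ⁅x, y⁆ z + ω ⁅y, z⁆ x + ω ⁅z, x⁆ y = 0

/-- `(L, ω)` and `(L', ω')` are symplectomorphically isomorphic: there is an isomorphism of Lie
algebras that carries `ω` to `ω'`. -/
def Symplectomorphic {L L' : Type*} [LieRing L] [LieAlgebra ℝ L] [LieRing L'] [LieAlgebra ℝ L']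
    (ω : L →ₗ[ℝ] L →ₗ[ℝ] ℝ) (ω' : L' →ₗ[ℝ] L' →ₗ[ℝ] ℝ) : Prop :=
  ∃ Φ : L ≃ₗ⁅ℝ⁆ L', ∀ x y, ω' (Φ x) (Φ y) = ω x y

/-- The `2`-form `e^{ij} = e^i ∧ e^j` on `ℝⁿ`. Coordinates are counted from `0`: the basis vector
`e_k` of the text has index `k - 1`. -/
noncomputable def wedgeForm {n : ℕ} (i j : Fin n) :
    (Fin n → ℝ) →ₗ[ℝ] (Fin n → ℝ) →ₗ[ℝ] ℝ :=
  LinearMap.mk₂ ℝ (fun x y => x i * y j - x j * y i)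
    (by intros; simp only [Pi.add_apply]; ring)
    (by intros; simp only [Pi.smul_apply, smul_eq_mul]; ring)
    (by intros; simp only [Pi.add_apply]; ring)
    (by intros; simp only [Pi.smul_apply, smul_eq_mul]; ring)

theorem wedgeForm_apply {n : ℕ} (i j : Fin n) (x y : Fin n → ℝ) :
    wedgeForm i j x y = x i * y j - x j * y i := rfl

/-- The standard basis vector of `ℝⁿ` with index `i`. -/
def stdVec {n : ℕ} (i : Fin n) : Fin n → ℝ := Pi.single i 1

/-! The Lie algebra `𝔤_(1,0,0,1)` -/

/-- The underlying space `ℝ⁶` of `𝔤_(1,0,0,1)`. -/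
def G6 : Type := Fin 6 → ℝ

noncomputable instance : AddCommGroup G6 := inferInstanceAs (AddCommGroup (Fin 6 → ℝ))
noncomputable instance : Module ℝ G6 := inferInstanceAs (Module ℝ (Fin 6 → ℝ))

/-- The bracket of `𝔤_(1,0,0,1)`:
`[e₁, e₅] = e₂`, `[e₂, e₅] = -e₁`, `[e₃, e₆] = e₄`, `[e₄, e₆] = -e₃`. -/
noncomputable def bracketG6 (x y : Fin 6 → ℝ) : Fin 6 → ℝ :=
  wedgeForm 0 4 x y • stdVec 1 - wedgeForm 1 4 x y • stdVec 0
    + wedgeForm 2 5 x y • stdVec 3 - wedgeForm 3 5 x y • stdVec 2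

theorem bracketG6_add_left (x y z : Fin 6 → ℝ) :
    bracketG6 (x + y) z = bracketG6 x z + bracketG6 y z := by
  funext i
  fin_cases i <;> simp [bracketG6, wedgeForm_apply, stdVec] <;> ring

theorem bracketG6_self (x : Fin 6 → ℝ) : bracketG6 x x = 0 := by
  funext i
  fin_cases i <;> simp [bracketG6, wedgeForm_apply, stdVec] <;> ring

theorem bracketG6_add_right (x y z : Fin 6 → ℝ) :
    bracketG6 x (y + z) = bracketG6 x y + bracketG6 x z := by
  funext i
  fin_cases i <;> simp [bracketG6, wedgeForm_apply, stdVec] <;> ring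

theorem bracketG6_smul (r : ℝ) (x y : Fin 6 → ℝ) :
    bracketG6 x (r • y) = r • bracketG6 x y := by
  funext i
  fin_cases i <;> simp [bracketG6, wedgeForm_apply, stdVec] <;> ring

theorem bracketG6_leibniz (x y z : Fin 6 → ℝ) :
    bracketG6 x (bracketG6 y z) =
      bracketG6 (bracketG6 x y) z + bracketG6 y (bracketG6 x z) := by
  funext i
  fin_cases i <;> simp [bracketG6, wedgeForm_apply, stdVec] <;> ring

noncomputable instance : LieRing G6 where
  bracket x y := bracketG6 x y
  add_lie := bracketG6_add_left 
  lie_add := bracketG6_add_right 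
  lie_self := bracketG6_self 
  leibniz_lie := bracketG6_leibniz 

noncomputable instance : LieAlgebra ℝ G6 where
  lie_smul := bracketG6_smul 

/-! Generalized symplectic oxidations -/

/-- The data that exhibit a symplectic Lie algebra `(𝔤, ω)` as a generalized symplectic oxidation
of the symplectic Lie algebra `(𝔥, ω')`: a decomposition `𝔤 = ℝℓ ⊕ 𝔥 ⊕ ℝξ` (with `𝔥` embedded by
the linear map `ι`), orthogonal for `ω` up to the pairing of `ℓ` with `ξ`, in which the bracket of
`𝔤` is given by an endomorphism `D` of `𝔥`, linear forms `μ`, `lam` on `𝔥` and a number `t`. The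
compatibility conditions between `D`, `μ`, `lam`, `t` are equivalent to the Jacobi identity of `𝔤`
and are therefore not repeated. -/
structure GeneralizedSymplecticOxidation {𝔤 𝔥 : Type*} [LieRing 𝔤] [LieAlgebra ℝ 𝔤]
    [LieRing 𝔥] [LieAlgebra ℝ 𝔥] (ω : 𝔤 →ₗ[ℝ] 𝔤 →ₗ[ℝ] ℝ) (ω' : 𝔥 →ₗ[ℝ] 𝔥 →ₗ[ℝ] ℝ) where
  ℓ : 𝔤
  ξ : 𝔤
  ι : 𝔥 →ₗ[ℝ] 𝔤
  D : 𝔥 →ₗ[ℝ] 𝔥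
  μ : 𝔥 →ₗ[ℝ] ℝ
  lam : 𝔥 →ₗ[ℝ] ℝ
  t : ℝ
  decomposition : Function.Bijective (fun p : ℝ × 𝔥 × ℝ => p.1 • ℓ + ι p.2.1 + p.2.2 • ξ)
  form_ι : ∀ x y, ω (ι x) (ι y) = ω' x y
  form_ℓ_ι : ∀ x, ω ℓ (ι x) = 0
  form_ξ_ι : ∀ x, ω ξ (ι x) = 0
  form_ℓ_ξ : ω ℓ ξ = 1
  lie_ι_ι : ∀ x y, ⁅ι x, ι y⁆ = ι ⁅x, y⁆ + (ω' (D x) y + ω' x (D y)) • ξ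
  lie_ξ_ι : ∀ x, ⁅ξ, ι x⁆ = -μ x • ξ
  lie_ξ_ℓ : ⁅ξ, ℓ⁆ = t • ξ
  lie_ℓ_ι : ∀ x, ⁅ℓ, ι x⁆ = μ x • ℓ + ι (D x) + lam x • ξ

namespace GeneralizedSymplecticOxidation

variable {𝔤 𝔥 : Type*} [LieRing 𝔤] [LieAlgebra ℝ 𝔤] [LieRing 𝔥] [LieAlgebra ℝ 𝔥]
  {ω : 𝔤 →ₗ[ℝ] 𝔤 →ₗ[ℝ] ℝ} {ω' : 𝔥 →ₗ[ℝ] 𝔥 →ₗ[ℝ] ℝ}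

/-- The oxidation is central: `ξ` lies in the centre of `𝔤`. -/
def IsCentral (O : GeneralizedSymplecticOxidation ω ω') : Prop :=
  O.ξ ∈ LieAlgebra.center ℝ 𝔤

/-- The oxidation is normal: the orthogonal `(ℝξ)^⊥ = {y | ω ξ y = 0}` is an ideal of `𝔤`. -/
def IsNormal (O : GeneralizedSymplecticOxidation ω ω') : Prop :=
  ∃ I : LieIdeal ℝ 𝔤, I.toSubmodule = LinearMap.ker (ω O.ξ)

end GeneralizedSymplecticOxidation

/-! The eight-dimensional families -/

/-- The underlying space `ℝ⁸` of the eight-dimensional Lie algebra with parameters `a`, `b`. -/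
def G8 (_a _b : ℝ) : Type := Fin 8 → ℝ

noncomputable instance (a b : ℝ) : AddCommGroup (G8 a b) :=
  inferInstanceAs (AddCommGroup (Fin 8 → ℝ))
noncomputable instance (a b : ℝ) : Module ℝ (G8 a b) := inferInstanceAs (Module ℝ (Fin 8 → ℝ))

/-- The bracket `[e₁, e₅] = e₂`, `[e₂, e₅] = -e₁`, `[e₃, e₆] = e₄`, `[e₄, e₆] = -e₃`,
`[e₇, e₅] = -a e₇`, `[e₇, e₆] = -b e₇`, `[e₈, e₅] = a e₈`, `[e₈, e₆] = b e₈`. -/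
noncomputable def bracketG8 (a b : ℝ) (x y : Fin 8 → ℝ) : Fin 8 → ℝ :=
  wedgeForm 0 4 x y • stdVec 1 - wedgeForm 1 4 x y • stdVec 0
    + wedgeForm 2 5 x y • stdVec 3 - wedgeForm 3 5 x y • stdVec 2
    - (a * wedgeForm 6 4 x y) • stdVec 6 - (b * wedgeForm 6 5 x y) • stdVec 6
    + (a * wedgeForm 7 4 x y) • stdVec 7 + (b * wedgeForm 7 5 x y) • stdVec 7

theorem bracketG8_add_left (a b : ℝ) (x y z : Fin 8 → ℝ) :
    bracketG8 a b (x + y) z = bracketG8 a b x z + bracketG8 a b y z := by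
  funext i
  fin_cases i <;> simp [bracketG8, wedgeForm_apply, stdVec] <;> ring

theorem bracketG8_self (a b : ℝ) (x : Fin 8 → ℝ) : bracketG8 a b x x = 0 := by
  funext i
  fin_cases i <;> simp [bracketG8, wedgeForm_apply, stdVec] <;> ring

theorem bracketG8_add_right (a b : ℝ) (x y z : Fin 8 → ℝ) :
    bracketG8 a b x (y + z) = bracketG8 a b x y + bracketG8 a b x z := by
  funext i
  fin_cases i <;> simp [bracketG8, wedgeForm_apply, stdVec] <;> ring

theorem bracketG8_smul (a b : ℝ) (r : ℝ) (x y : Fin 8 → ℝ) :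
    bracketG8 a b x (r • y) = r • bracketG8 a b x y := by
  funext i
  fin_cases i <;> simp [bracketG8, wedgeForm_apply, stdVec] <;> ring

theorem bracketG8_leibniz (a b : ℝ) (x y z : Fin 8 → ℝ) :
    bracketG8 a b x (bracketG8 a b y z) =
      bracketG8 a b (bracketG8 a b x y) z + bracketG8 a b y (bracketG8 a b x z) := by
  funext i
  fin_cases i <;> simp [bracketG8, wedgeForm_apply, stdVec] <;> ring

noncomputable instance (a b : ℝ) : LieRing (G8 a b) where
  bracket x y := bracketG8 a b x y
  add_lie := bracketG8_add_left a b 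
  lie_add := bracketG8_add_right a b 
  lie_self := bracketG8_self a b 
  leibniz_lie := bracketG8_leibniz a b 

noncomputable instance (a b : ℝ) : LieAlgebra ℝ (G8 a b) where
  lie_smul := bracketG8_smul a b 

/-- The form `e^{12} + e^{34} + η e^{56} + e^{78}`. -/
noncomputable def formG8 (a b η : ℝ) : G8 a b →ₗ[ℝ] G8 a b →ₗ[ℝ] ℝ :=
  (wedgeForm 0 1 + wedgeForm 2 3 + η • wedgeForm 4 5 + wedgeForm 6 7 :
    (Fin 8 → ℝ) →ₗ[ℝ] (Fin 8 → ℝ) →ₗ[ℝ] ℝ)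

/-! The Jacobi identity of 𝔤 turns the oxidation data into cohomology. The form `μ` is a character
of the six-dimensional algebra, and it is nonzero because the oxidation is not normal. The map `D`
is a 1-cocycle with values in the adjoint representation twisted by `μ`. Once `D = 0` and `t = 0`,
`lam` is a 1-cocycle for the character 2μ.

Both cohomology groups vanish. A character lives on the span of e₅ and e₆, so some x₀ = p e₅ + q e₆
has μ(x₀) = 1. Its adjoint action is skew, hence has imaginary spectrum, and shifting by a nonzero
real number makes it invertible (`cocycle_eq_coboundary`, `scalar_cocycle_eq_smul`). Coboundaries
are absorbed into a new choice of ℓ and of the complement (`exists_D_eq_zero`,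
`exists_lam_eq_zero`), after which only `μ` is left.

Automorphisms bring the symplectic form to e¹² + e³⁴ + η e⁵⁶ with η > 0 (`exists_normal_form`). Then
μ = a e⁵ + b e⁶ with (a, b) ≠ 0, and the three families record which of a, b vanish. -/

theorem skew_of_alt {L : Type*} [AddCommGroup L] [Module ℝ L] {ω : L →ₗ[ℝ] L →ₗ[ℝ] ℝ}
    (hω : ∀ x, ω x x = 0) (x y : L) : ω x y = -ω y x := by
  have := hω (x + y)
  simp only [map_add, LinearMap.add_apply, hω] at this
  linarith

namespace GeneralizedSymplecticOxidation

/-! ### Consequences of the Jacobi identity -/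

section Jacobi

variable {𝔤 𝔥 : Type*} [LieRing 𝔤] [LieAlgebra ℝ 𝔤] [LieRing 𝔥] [LieAlgebra ℝ 𝔥]
  {ω : 𝔤 →ₗ[ℝ] 𝔤 →ₗ[ℝ] ℝ} {ω' : 𝔥 →ₗ[ℝ] 𝔥 →ₗ[ℝ] ℝ}

theorem components_eq (O : GeneralizedSymplecticOxidation ω ω') {a b a' b' : ℝ} {x x' : 𝔥}
    (h : a • O.ℓ + O.ι x + b • O.ξ = a' • O.ℓ + O.ι x' + b' • O.ξ) :
    a = a' ∧ x = x' ∧ b = b' := by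
  have := O.decomposition.injective (a₁ := (a, x, b)) (a₂ := (a', x', b')) h
  simpa using this

theorem ξ_ne_zero (O : GeneralizedSymplecticOxidation ω ω') : O.ξ ≠ 0 := by
  intro h
  have := O.form_ℓ_ξ
  simp [h] at this

theorem lie_ι_ξ (O : GeneralizedSymplecticOxidation ω ω') (x : 𝔥) :
    ⁅O.ι x, O.ξ⁆ = O.μ x • O.ξ := by
  rw [← lie_skew, O.lie_ξ_ι, neg_smul, neg_neg]

theorem lie_ℓ_ξ (O : GeneralizedSymplecticOxidation ω ω') :
    ⁅O.ℓ, O.ξ⁆ = -O.t • O.ξ := by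
  rw [← lie_skew, O.lie_ξ_ℓ, neg_smul]

theorem lie_ι_ℓ (O : GeneralizedSymplecticOxidation ω ω') (x : 𝔥) :
    ⁅O.ι x, O.ℓ⁆ = -(O.μ x • O.ℓ + O.ι (O.D x) + O.lam x • O.ξ) := by
  rw [← lie_skew, O.lie_ℓ_ι]

/-- Jacobi for ξ, x, y: the elements of 𝔥 act on the line ℝξ by scalars, and scalars commute. -/
theorem μ_lie (O : GeneralizedSymplecticOxidation ω ω') (x y : 𝔥) : O.μ ⁅x, y⁆ = 0 := by
  have h := leibniz_lie O.ξ (O.ι x) (O.ι y)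
  simp only [O.lie_ι_ι, lie_add, lie_smul, smul_lie, O.lie_ξ_ι, O.lie_ι_ξ, lie_self] at h
  have h' : (O.μ ⁅x, y⁆) • O.ξ = 0 := by
    linear_combination (norm := module) -h
  exact (smul_eq_zero.1 h').resolve_right O.ξ_ne_zero

theorem μ_D (O : GeneralizedSymplecticOxidation ω ω') (x : 𝔥) : O.μ (O.D x) = O.t * O.μ x := by
  have h := leibniz_lie O.ξ O.ℓ (O.ι x)
  simp only [O.lie_ℓ_ι, lie_add, lie_smul, smul_lie, O.lie_ξ_ι, O.lie_ξ_ℓ, O.lie_ℓ_ξ,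
    lie_self] at h
  have h' : (O.μ (O.D x) - O.t * O.μ x) • O.ξ = 0 := by
    linear_combination (norm := module) -h
  exact sub_eq_zero.1 ((smul_eq_zero.1 h').resolve_right O.ξ_ne_zero)

/-- These are the 𝔥- and ξ-components of the Jacobi identity for ℓ, x, y. The first is the cocycle
condition for `D` in the adjoint representation twisted by `μ`. When `D = 0`, the second is the
cocycle condition for `lam` in the character 2μ. -/
theorem leibniz_components (O : GeneralizedSymplecticOxidation ω ω') (x y : 𝔥) :
    O.D ⁅x, y⁆ = ⁅O.D x, y⁆ + ⁅x, O.D y⁆ + O.μ x • O.D y - O.μ y • O.D x ∧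
    O.lam ⁅x, y⁆ - O.t * (ω' (O.D x) y + ω' x (O.D y)) =
      (ω' (O.D (O.D x)) y + ω' (O.D x) (O.D y)) + (ω' (O.D x) (O.D y) + ω' x (O.D (O.D y)))
        + 2 * (O.μ x * O.lam y - O.μ y * O.lam x) := by
  have h := leibniz_lie O.ℓ (O.ι x) (O.ι y)
  simp only [O.lie_ι_ι, O.lie_ℓ_ι, O.lie_ι_ℓ, lie_add, add_lie, lie_smul, smul_lie, O.lie_ξ_ι,
    O.lie_ℓ_ξ, O.lie_ι_ξ] at h
  have := O.components_eq (a := O.μ ⁅x, y⁆) (a' := 0) (x := O.D ⁅x, y⁆)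
    (x' := ⁅O.D x, y⁆ + ⁅x, O.D y⁆ + O.μ x • O.D y - O.μ y • O.D x)
    (b := O.lam ⁅x, y⁆ - O.t * (ω' (O.D x) y + ω' x (O.D y)))
    (b' := (ω' (O.D (O.D x)) y + ω' (O.D x) (O.D y))
      + (ω' (O.D x) (O.D y) + ω' x (O.D (O.D y)))
        + 2 * (O.μ x * O.lam y - O.μ y * O.lam x)) (by
      simp only [map_add, map_sub, map_smul]
      linear_combination (norm := module) h)
  exact this.2

/-- If `μ = 0`, the oxidation is normal. -/
theorem exists_μ_ne_zero (O : GeneralizedSymplecticOxidation ω ω') (hω : ∀ x, ω x x = 0)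
    (hnormal : ¬ O.IsNormal) : ∃ x, O.μ x ≠ 0 := by
  by_contra! hμ
  refine hnormal ⟨{ LinearMap.ker (ω O.ξ) with lie_mem := ?_ }, rfl⟩
  have hskew : ∀ x y, ω x y = -ω y x := skew_of_alt hω
  have hξℓ : ω O.ξ O.ℓ = -1 := by rw [hskew, O.form_ℓ_ξ]
  intro x m hm
  change ω O.ξ m = 0 at hm
  change ω O.ξ ⁅x, m⁆ = 0
  obtain ⟨⟨a, y, b⟩, rfl⟩ := O.decomposition.surjective x
  obtain ⟨⟨a', z, b'⟩, rfl⟩ := O.decomposition.surjective m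
  simp only [map_add, map_smul, O.form_ξ_ι, hξℓ, hω, smul_eq_mul] at hm
  have ha' : a' = 0 := by linarith
  subst ha'
  -- An element of the kernel has no ℓ-component, so a bracket with it can acquire one only through
  -- `μ`.
  simp only [lie_add, add_lie, smul_lie, lie_smul, O.lie_ι_ι, O.lie_ℓ_ι, O.lie_ξ_ι, O.lie_ℓ_ξ,
    O.lie_ι_ξ, lie_self, map_add, map_smul, O.form_ξ_ι, hω, hμ]
  simp

/-! ### Changing the decomposition -/

/-- A coboundary `D` can be removed by moving `ℓ` and the copy of `𝔥`. -/
theorem exists_D_eq_zero (O : GeneralizedSymplecticOxidation ω ω') (hω : ∀ x, ω x x = 0)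
    (hω' : IsSymplecticForm ω') {x₀ : 𝔥} (hx₀ : O.μ x₀ = 1) {v : 𝔥}
    (hv : ∀ x, O.D x = ⁅x, v⁆ + O.μ x • v) :
    ∃ O' : GeneralizedSymplecticOxidation ω ω', O'.μ = O.μ ∧ O'.D = 0 ∧ O'.t = 0 := by
  have hskew : ∀ x y, ω x y = -ω y x := skew_of_alt hω
  have hskew' : ∀ x y, ω' x y = -ω' y x := skew_of_alt hω'.alt
  have ht : O.t = O.μ v := by
    have := O.μ_D x₀
    simp only [hv, map_add, O.μ_lie, map_smul, hx₀, smul_eq_mul] at this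
    linarith
  have hιξ : ∀ x, ω (O.ι x) O.ξ = 0 := fun x => by rw [hskew, O.form_ξ_ι, neg_zero]
  -- Subtracting ω'(v, ·)ξ from `ι` keeps the complement orthogonal to the new ℓ. The correction to
  -- `lam` is the ξ-part of the bracket of ι v with ι x.
  refine ⟨{
    ℓ := O.ℓ + O.ι v
    ξ := O.ξ
    ι := O.ι - (ω' v).smulRight O.ξ
    D := 0
    μ := O.μ
    lam := O.lam + (ω' (O.D v) + (ω' v).comp O.D)
    t := 0
    decomposition := ?_
    form_ι := ?_
    form_ℓ_ι := ?_
    form_ξ_ι := ?_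
    form_ℓ_ξ := ?_
    lie_ι_ι := ?_
    lie_ξ_ι := ?_
    lie_ξ_ℓ := ?_
    lie_ℓ_ι := ?_ }, rfl, rfl, rfl⟩
  · constructor
    · rintro ⟨a, x, b⟩ ⟨a', x', b'⟩ h
      have := O.components_eq (a := a) (a' := a') (x := a • v + x) (x' := a' • v + x')
        (b := b - ω' v x) (b' := b' - ω' v x') (by
          simp only [LinearMap.sub_apply, LinearMap.smulRight_apply] at h
          simp only [map_add, map_smul]
          linear_combination (norm := module) h)
      obtain ⟨rfl, h2, h3⟩ := this
      obtain rfl := add_left_cancel h2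
      obtain rfl := sub_left_injective h3
      rfl
    · intro y
      obtain ⟨⟨a, x, b⟩, rfl⟩ := O.decomposition.surjective y
      refine ⟨(a, x - a • v, b + ω' v x - a * ω' v v), ?_⟩
      simp only [LinearMap.sub_apply, LinearMap.smulRight_apply, map_sub, map_smul]
      module
  · intro x y
    simp [hιξ, O.form_ι, O.form_ξ_ι, hω]
  · intro x
    simp [hιξ, O.form_ι, O.form_ℓ_ι, O.form_ℓ_ξ]
  · intro x
    simp [O.form_ξ_ι, hω]
  · simp [hιξ, O.form_ℓ_ξ]
  · intro x y
    -- Closedness of ω' is what removes the ξ-component of the bracket on the new complement.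
    have hc := hω'.closed x v y
    rw [← lie_skew v y, ← lie_skew y x, map_neg, LinearMap.neg_apply, map_neg,
      LinearMap.neg_apply, hskew' ⁅y, v⁆ x, hskew' ⁅x, y⁆ v] at hc
    simp only [LinearMap.sub_apply, LinearMap.smulRight_apply, lie_sub, sub_lie, lie_smul,
      smul_lie, O.lie_ι_ι, O.lie_ι_ξ, O.lie_ξ_ι, lie_self, LinearMap.zero_apply, map_zero, hv,
      map_add, LinearMap.add_apply, map_smul, LinearMap.smul_apply, smul_eq_mul, hskew' x v]
    linear_combination (norm := module) hc • O.ξ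
  · intro x
    simp [O.lie_ξ_ι]
  · simp only [lie_add, O.lie_ξ_ℓ, O.lie_ξ_ι, ht]
    module
  · intro x
    simp only [LinearMap.sub_apply, LinearMap.smulRight_apply, lie_sub, add_lie, lie_smul,
      O.lie_ι_ι, O.lie_ℓ_ι, O.lie_ℓ_ξ, O.lie_ι_ξ, ht, LinearMap.add_apply, LinearMap.comp_apply,
      LinearMap.zero_apply, map_zero]
    rw [hv x, ← lie_skew x v]
    simp only [map_add, map_neg, map_smul]
    module

/-- If `D = 0` and `t = 0`, a form `lam` proportional to `μ` can be removed by moving `ℓ`. -/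
theorem exists_lam_eq_zero (O : GeneralizedSymplecticOxidation ω ω') (hω : ∀ x, ω x x = 0)
    (hD : O.D = 0) (ht : O.t = 0) {s : ℝ} (hs : ∀ x, O.lam x = s * O.μ x) :
    ∃ O' : GeneralizedSymplecticOxidation ω ω',
      O'.μ = O.μ ∧ O'.D = 0 ∧ O'.t = 0 ∧ O'.lam = 0 := by
  -- The factor 1/2 appears because 𝔥 acts on ξ and ℓ with opposite characters: adding cξ to ℓ
  -- changes `lam` by -2cμ.
  refine ⟨{
    ℓ := O.ℓ + (s / 2) • O.ξ
    ξ := O.ξ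
    ι := O.ι
    D := 0
    μ := O.μ
    lam := 0
    t := 0
    decomposition := ?_
    form_ι := O.form_ι
    form_ℓ_ι := ?_
    form_ξ_ι := O.form_ξ_ι
    form_ℓ_ξ := ?_
    lie_ι_ι := ?_
    lie_ξ_ι := O.lie_ξ_ι
    lie_ξ_ℓ := ?_
    lie_ℓ_ι := ?_ }, rfl, rfl, rfl, rfl⟩
  · constructor
    · rintro ⟨a, x, b⟩ ⟨a', x', b'⟩ h
      have := O.components_eq (a := a) (a' := a') (x := x) (x' := x')
        (b := b + a * (s / 2)) (b' := b' + a' * (s / 2)) (by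
          simp only at h
          linear_combination (norm := module) h)
      obtain ⟨rfl, rfl, h3⟩ := this
      obtain rfl := add_right_cancel h3
      rfl
    · intro y
      obtain ⟨⟨a, x, b⟩, rfl⟩ := O.decomposition.surjective y
      refine ⟨(a, x, b - a * (s / 2)), ?_⟩
      simp only
      module
  · intro x
    simp [O.form_ℓ_ι, O.form_ξ_ι]
  · simp [O.form_ℓ_ξ, hω]
  · intro x y
    simpa [hD] using O.lie_ι_ι x y
  · simp [O.lie_ξ_ℓ, ht]
  · intro x
    simp only [add_lie, smul_lie, O.lie_ℓ_ι, O.lie_ξ_ι, hD, hs, LinearMap.zero_apply, map_zero]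
    module

end Jacobi

end GeneralizedSymplecticOxidation

/-! ### Coordinates and brackets of the six-dimensional algebra -/

namespace G6

/-- The coordinates on `𝔤_(1,0,0,1)`. -/
noncomputable def coord (i : Fin 6) : G6 →ₗ[ℝ] ℝ := (LinearMap.proj i : (Fin 6 → ℝ) →ₗ[ℝ] ℝ)

/-- The element of `𝔤_(1,0,0,1)` with given coordinates. -/
noncomputable def mk (x : Fin 6 → ℝ) : G6 := x

@[simp] theorem coord_mk (x : Fin 6 → ℝ) (i : Fin 6) : coord i (mk x) = x i := rfl

theorem ext_coord {x y : G6} (h0 : coord 0 x = coord 0 y) (h1 : coord 1 x = coord 1 y)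
    (h2 : coord 2 x = coord 2 y) (h3 : coord 3 x = coord 3 y) (h4 : coord 4 x = coord 4 y)
    (h5 : coord 5 x = coord 5 y) : x = y := by
  refine funext fun i => ?_
  fin_cases i
  exacts [h0, h1, h2, h3, h4, h5]

theorem _root_.bracketG6_apply (x y : Fin 6 → ℝ) :
    bracketG6 x y 0 = -(x 1 * y 4 - y 1 * x 4) ∧ bracketG6 x y 1 = x 0 * y 4 - y 0 * x 4 ∧
    bracketG6 x y 2 = -(x 3 * y 5 - y 3 * x 5) ∧ bracketG6 x y 3 = x 2 * y 5 - y 2 * x 5 ∧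
    bracketG6 x y 4 = 0 ∧ bracketG6 x y 5 = 0 := by
  refine ⟨?_, ?_, ?_, ?_, ?_, ?_⟩ <;> simp [bracketG6, wedgeForm_apply, stdVec] <;> ring

theorem coord_lie (x y : G6) :
    coord 0 ⁅x, y⁆ = -(coord 1 x * coord 4 y - coord 1 y * coord 4 x) ∧
    coord 1 ⁅x, y⁆ = coord 0 x * coord 4 y - coord 0 y * coord 4 x ∧
    coord 2 ⁅x, y⁆ = -(coord 3 x * coord 5 y - coord 3 y * coord 5 x) ∧
    coord 3 ⁅x, y⁆ = coord 2 x * coord 5 y - coord 2 y * coord 5 x ∧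
    coord 4 ⁅x, y⁆ = 0 ∧ coord 5 ⁅x, y⁆ = 0 :=
  bracketG6_apply x y

/-- The basis vectors of `𝔤_(1,0,0,1)`. -/
noncomputable def e (i : Fin 6) : G6 := mk (fun j => if j = i then 1 else 0)

theorem coord_e (i j : Fin 6) : coord j (e i) = if j = i then 1 else 0 := rfl

theorem eq_sum_e (x : G6) : x = coord 0 x • e 0 + coord 1 x • e 1 + coord 2 x • e 2
    + coord 3 x • e 3 + coord 4 x • e 4 + coord 5 x • e 5 := by
  apply ext_coord <;> simp [coord_e]

theorem linearMap_eq_zero {M : Type*} [AddCommGroup M] [Module ℝ M] {f : G6 →ₗ[ℝ] M}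
    (h0 : f (e 0) = 0) (h1 : f (e 1) = 0) (h2 : f (e 2) = 0) (h3 : f (e 3) = 0)
    (h4 : f (e 4) = 0) (h5 : f (e 5) = 0) : f = 0 := by
  ext x
  rw [eq_sum_e x]
  simp [h0, h1, h2, h3, h4, h5]

theorem lie_e04 : ⁅e 0, e 4⁆ = e 1 := by apply ext_coord <;> simp [coord_lie, coord_e]
theorem lie_e14 : ⁅e 1, e 4⁆ = -e 0 := by apply ext_coord <;> simp [coord_lie, coord_e]
theorem lie_e25 : ⁅e 2, e 5⁆ = e 3 := by apply ext_coord <;> simp [coord_lie, coord_e]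
theorem lie_e35 : ⁅e 3, e 5⁆ = -e 2 := by apply ext_coord <;> simp [coord_lie, coord_e]

/-- A linear form that vanishes on brackets is a combination of the coordinates `4` and `5`. -/
theorem form_apply_of_lie_eq_zero {f : G6 →ₗ[ℝ] ℝ} (hf : ∀ x y : G6, f ⁅x, y⁆ = 0) (x : G6) :
    f x = f (e 4) * coord 4 x + f (e 5) * coord 5 x := by
  have h0 := hf (e 1) (e 4)
  have h1 := hf (e 0) (e 4)
  have h2 := hf (e 3) (e 5)
  have h3 := hf (e 2) (e 5)
  rw [lie_e14, map_neg, neg_eq_zero] at h0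
  rw [lie_e04] at h1
  rw [lie_e35, map_neg, neg_eq_zero] at h2
  rw [lie_e25] at h3
  conv_lhs => rw [eq_sum_e x]
  simp [h0, h1, h2, h3, mul_comm]

/-! ### Vanishing of the twisted cohomology -/

/-- `ad (p e₅ + q e₆)` is skew, so `1 + ad (p e₅ + q e₆)` does not rotate a plane into itself. -/
theorem eq_zero_of_rotation {p q r : ℝ} {u w : G6}
    (hu : ⁅p • e 4 + q • e 5, u⁆ + u = -r • w) (hw : ⁅p • e 4 + q • e 5, w⁆ + w = r • u) :
    u = 0 ∧ w = 0 := by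
  have E (i : Fin 6) := congrArg (coord i) hu
  have F (i : Fin 6) := congrArg (coord i) hw
  have E0 := E 0
  have E1 := E 1
  have E2 := E 2
  have E3 := E 3
  have E4 := E 4
  have E5 := E 5
  have F0 := F 0
  have F1 := F 1
  have F2 := F 2
  have F3 := F 3
  have F4 := F 4
  have F5 := F 5
  clear E F
  simp [coord_lie, coord_e] at E0 E1 E2 E3 E4 E5 F0 F1 F2 F3 F4 F5
  -- Pair the first equation with u and the second with w in the standard inner product: skewness
  -- kills the `ad` terms and the two terms in r cancel.
  have hsum : coord 0 u ^ 2 + coord 1 u ^ 2 + coord 2 u ^ 2 + coord 3 u ^ 2 + coord 4 u ^ 2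
      + coord 5 u ^ 2 + (coord 0 w ^ 2 + coord 1 w ^ 2 + coord 2 w ^ 2 + coord 3 w ^ 2
      + coord 4 w ^ 2 + coord 5 w ^ 2) = 0 := by
    linear_combination coord 0 u * E0 + coord 1 u * E1 + coord 2 u * E2 + coord 3 u * E3
      + coord 4 u * E4 + coord 5 u * E5 + coord 0 w * F0 + coord 1 w * F1 + coord 2 w * F2
      + coord 3 w * F3 + coord 4 w * F4 + coord 5 w * F5
  constructor <;> apply ext_coord <;> rw [map_zero] <;> refine pow_eq_zero_iff two_ne_zero |>.1 ?_
    <;> refine le_antisymm ?_ (sq_nonneg _) <;> rw [← hsum] <;> rw [← sub_nonneg] <;> ring_nf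
    <;> positivity

theorem one_add_ad_injective (p q : ℝ) {u : G6} (hu : ⁅p • e 4 + q • e 5, u⁆ + u = 0) : u = 0 :=
  (eq_zero_of_rotation (r := 0) (w := u) (by simpa using hu) (by simpa using hu)).1

theorem exists_one_add_ad (p q : ℝ) (w : G6) : ∃ v, ⁅p • e 4 + q • e 5, v⁆ + v = w := by
  have : FiniteDimensional ℝ G6 := inferInstanceAs (FiniteDimensional ℝ (Fin 6 → ℝ))
  let f : G6 →ₗ[ℝ] G6 := (LieAlgebra.ad ℝ G6 (p • e 4 + q • e 5) : G6 →ₗ[ℝ] G6) + LinearMap.id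
  have hf : Function.Injective f := by
    rw [← LinearMap.ker_eq_bot, LinearMap.ker_eq_bot']
    exact fun u hu => one_add_ad_injective p q hu
  exact LinearMap.injective_iff_surjective.1 hf w

theorem lie_ad_e (p q : ℝ) :
    ⁅p • e 4 + q • e 5, e 0⁆ = -p • e 1 ∧ ⁅p • e 4 + q • e 5, e 1⁆ = p • e 0 ∧
    ⁅p • e 4 + q • e 5, e 2⁆ = -q • e 3 ∧ ⁅p • e 4 + q • e 5, e 3⁆ = q • e 2 ∧
    ⁅p • e 4 + q • e 5, e 4⁆ = 0 ∧ ⁅p • e 4 + q • e 5, e 5⁆ = 0 := by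
  refine ⟨?_, ?_, ?_, ?_, ?_, ?_⟩ <;> apply ext_coord <;> simp [coord_lie, coord_e]

/-- The normalising vector can be taken in the span of `e 4` and `e 5`, whose adjoint action is
skew. -/
theorem exists_eq_one {μ : G6 →ₗ[ℝ] ℝ} (hμ : ∀ x y : G6, μ ⁅x, y⁆ = 0) (hne : ∃ x, μ x ≠ 0) :
    ∃ p q : ℝ, μ (p • e 4 + q • e 5) = 1 := by
  obtain ⟨x, hx⟩ := hne
  refine ⟨coord 4 x / μ x, coord 5 x / μ x, ?_⟩
  have h := form_apply_of_lie_eq_zero hμ x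
  simp only [map_add, map_smul, smul_eq_mul]
  field_simp
  linarith

/-- The first cohomology of `𝔤_(1,0,0,1)` with values in the adjoint representation twisted by a
non-trivial character vanishes. -/
theorem cocycle_eq_coboundary {μ : G6 →ₗ[ℝ] ℝ} {p q : ℝ} (hpq : μ (p • e 4 + q • e 5) = 1)
    (hμ : ∀ x y : G6, μ ⁅x, y⁆ = 0) {D : G6 →ₗ[ℝ] G6}
    (hD : ∀ x y : G6, D ⁅x, y⁆ = ⁅D x, y⁆ + ⁅x, D y⁆ + μ x • D y - μ y • D x) :
    ∃ v, ∀ x, D x = ⁅x, v⁆ + μ x • v := by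
  obtain ⟨v, hv⟩ := exists_one_add_ad p q (D (p • e 4 + q • e 5))
  refine ⟨v, ?_⟩
  -- `T` is `D` minus the coboundary of v, and v was chosen so that `T` vanishes at x₀ = p e₅ + q
  -- e₆. The cocycle condition then reads (1 + ad x₀) ∘ T = T ∘ ad x₀. The spectra of 1 + ad x₀ and
  -- ad x₀ are disjoint, which forces T = 0.
  set T : G6 →ₗ[ℝ] G6 := D + (LieAlgebra.ad ℝ G6 v : G6 →ₗ[ℝ] G6) - μ.smulRight v with hT
  have hTx : ∀ x, T x = D x + ⁅v, x⁆ - μ x • v := fun _ => rfl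
  have key : ∀ y, ⁅p • e 4 + q • e 5, T y⁆ + T y = T ⁅p • e 4 + q • e 5, y⁆ := by
    intro y
    generalize p • e 4 + q • e 5 = x₀ at *
    have hJ := leibniz_lie v x₀ y
    rw [hTx, hTx, hD, hμ, hpq, ← hv, hJ, lie_sub, lie_add, lie_smul, add_lie,
      ← lie_skew v x₀, neg_lie]
    module
  obtain ⟨h0, h1, h2, h3, h4, h5⟩ := lie_ad_e p q
  have k0 := key (e 0)
  have k1 := key (e 1)
  have k2 := key (e 2)
  have k3 := key (e 3)
  have k4 := key (e 4)
  have k5 := key (e 5)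
  rw [h0, map_smul] at k0
  rw [h1, map_smul] at k1
  rw [h2, map_smul] at k2
  rw [h3, map_smul] at k3
  rw [h4, map_zero] at k4
  rw [h5, map_zero] at k5
  have hT0 : T = 0 := linearMap_eq_zero (eq_zero_of_rotation k0 k1).1 (eq_zero_of_rotation k0 k1).2
    (eq_zero_of_rotation k2 k3).1 (eq_zero_of_rotation k2 k3).2 (one_add_ad_injective p q k4)
    (one_add_ad_injective p q k5)
  intro x
  have := hTx x
  rw [hT0, LinearMap.zero_apply] at this
  rw [← lie_skew]
  linear_combination (norm := module) -this

/-- The first cohomology of `𝔤_(1,0,0,1)` with values in a non-trivial character vanishes. -/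
theorem scalar_cocycle_eq_smul {μ lam : G6 →ₗ[ℝ] ℝ} {p q : ℝ}
    (hpq : μ (p • e 4 + q • e 5) = 1) (hμ : ∀ x y : G6, μ ⁅x, y⁆ = 0)
    (hlam : ∀ x y : G6, lam ⁅x, y⁆ = 2 * (μ x * lam y - μ y * lam x)) :
    ∃ s, ∀ x, lam x = s * μ x := by
  refine ⟨lam (p • e 4 + q • e 5), ?_⟩
  set T : G6 →ₗ[ℝ] ℝ := lam - lam (p • e 4 + q • e 5) • μ with hT
  have hTx : ∀ x, T x = lam x - lam (p • e 4 + q • e 5) * μ x := fun _ => rfl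
  -- Composition with ad x₀ multiplies `T` by 2, whereas ad x₀ has no real nonzero eigenvalue.
  have key : ∀ y, T ⁅p • e 4 + q • e 5, y⁆ = 2 * T y := by
    intro y
    rw [hTx, hTx, hlam, hμ, hpq]
    ring
  obtain ⟨h0, h1, h2, h3, h4, h5⟩ := lie_ad_e p q
  have k0 := key (e 0)
  have k1 := key (e 1)
  have k2 := key (e 2)
  have k3 := key (e 3)
  have k4 := key (e 4)
  have k5 := key (e 5)
  rw [h0, map_smul, smul_eq_mul] at k0
  rw [h1, map_smul, smul_eq_mul] at k1
  rw [h2, map_smul, smul_eq_mul] at k2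
  rw [h3, map_smul, smul_eq_mul] at k3
  rw [h4, map_zero] at k4
  rw [h5, map_zero] at k5
  have aux : ∀ {r a b : ℝ}, -r * b = 2 * a → r * a = 2 * b → a = 0 ∧ b = 0 := by
    intro r a b ha hb
    have h : a * a + b * b = 0 := by linear_combination -(a / 2) * ha - (b / 2) * hb
    exact mul_self_add_mul_self_eq_zero.1 h
  have hT0 : T = 0 := linearMap_eq_zero (aux k0 k1).1 (aux k0 k1).2 (aux k2 k3).1 (aux k2 k3).2
    (by linarith) (by linarith)
  intro x
  have := hTx x
  rw [hT0, LinearMap.zero_apply] at this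
  linarith

/-! ### Normal form of the symplectic forms -/

/-- The closed `2`-forms on `𝔤_(1,0,0,1)`. -/
theorem closed_form_apply {ω : G6 →ₗ[ℝ] G6 →ₗ[ℝ] ℝ} (hω : IsSymplecticForm ω) :
    ∃ a b c p q r s : ℝ, ∀ x y, ω x y =
      a * (coord 0 x * coord 1 y - coord 1 x * coord 0 y)
      + b * (coord 2 x * coord 3 y - coord 3 x * coord 2 y)
      + c * (coord 4 x * coord 5 y - coord 5 x * coord 4 y)
      + p * (coord 0 x * coord 4 y - coord 4 x * coord 0 y)
      + q * (coord 1 x * coord 4 y - coord 4 x * coord 1 y)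
      + r * (coord 2 x * coord 5 y - coord 5 x * coord 2 y)
      + s * (coord 3 x * coord 5 y - coord 5 x * coord 3 y) := by
  have hskew : ∀ x y, ω y x = -ω x y := fun x y =>
    skew_of_alt hω.alt y x
  -- If z commutes with x and y, closedness leaves only ω([x, y], z) = 0. This kills eight of the
  -- fifteen coefficients.
  have hz : ∀ x y z w : G6, ⁅x, y⁆ = w → ⁅y, z⁆ = 0 → ⁅z, x⁆ = 0 → ω w z = 0 := by
    intro x y z w h1 h2 h3
    have := hω.closed x y z
    simpa [h1, h2, h3] using this
  have hz' : ∀ x y z w : G6, ⁅x, y⁆ = -w → ⁅y, z⁆ = 0 → ⁅z, x⁆ = 0 → ω w z = 0 := by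
    intro x y z w h1 h2 h3
    simpa using hz x y z (-w) h1 h2 h3
  have hl : ∀ i j, coord 0 ⁅e i, e j⁆ = 0 → coord 1 ⁅e i, e j⁆ = 0 → coord 2 ⁅e i, e j⁆ = 0 →
      coord 3 ⁅e i, e j⁆ = 0 → ⁅e i, e j⁆ = 0 := by
    intro i j h0 h1 h2 h3
    refine ext_coord ?_ ?_ ?_ ?_ ?_ ?_ <;> rw [map_zero]
    exacts [h0, h1, h2, h3, (coord_lie _ _).2.2.2.2.1, (coord_lie _ _).2.2.2.2.2]
  have h02 : ω (e 0) (e 2) = 0 := by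
    apply hz' _ _ _ _ lie_e14 <;> apply hl <;> simp [coord_lie, coord_e]
  have h03 : ω (e 0) (e 3) = 0 := by
    apply hz' _ _ _ _ lie_e14 <;> apply hl <;> simp [coord_lie, coord_e]
  have h05 : ω (e 0) (e 5) = 0 := by
    apply hz' _ _ _ _ lie_e14 <;> apply hl <;> simp [coord_lie, coord_e]
  have h12 : ω (e 1) (e 2) = 0 := by
    apply hz _ _ _ _ lie_e04 <;> apply hl <;> simp [coord_lie, coord_e]
  have h13 : ω (e 1) (e 3) = 0 := by
    apply hz _ _ _ _ lie_e04 <;> apply hl <;> simp [coord_lie, coord_e]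
  have h15 : ω (e 1) (e 5) = 0 := by
    apply hz _ _ _ _ lie_e04 <;> apply hl <;> simp [coord_lie, coord_e]
  have h24 : ω (e 2) (e 4) = 0 := by
    apply hz' _ _ _ _ lie_e35 <;> apply hl <;> simp [coord_lie, coord_e]
  have h34 : ω (e 3) (e 4) = 0 := by
    apply hz _ _ _ _ lie_e25 <;> apply hl <;> simp [coord_lie, coord_e]
  refine ⟨ω (e 0) (e 1), ω (e 2) (e 3), ω (e 4) (e 5), ω (e 0) (e 4), ω (e 1) (e 4),
    ω (e 2) (e 5), ω (e 3) (e 5), fun x y => ?_⟩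
  conv_lhs => rw [eq_sum_e x, eq_sum_e y]
  simp only [map_add, LinearMap.add_apply, map_smul, LinearMap.smul_apply, smul_eq_mul, hω.alt,
    hskew (e 0) (e 1), hskew (e 2) (e 3), hskew (e 4) (e 5), hskew (e 0) (e 4), hskew (e 1) (e 4),
    hskew (e 2) (e 5), hskew (e 3) (e 5), hskew (e 0) (e 2), hskew (e 0) (e 3), hskew (e 0) (e 5),
    hskew (e 1) (e 2), hskew (e 1) (e 3), hskew (e 1) (e 5), hskew (e 2) (e 4), hskew (e 3) (e 4),
    h02, h03, h05, h12, h13, h15, h24, h34]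
  ring

/-- The endomorphism of `𝔤_(1,0,0,1)` that scales and reflects the two rotation planes and
translates the rotation generators. -/
noncomputable def planeHom (s₁ s₂ ε₁ ε₂ α β γ δ : ℝ) (h₁ : ε₁ * ε₁ = 1) (h₂ : ε₂ * ε₂ = 1) : G6 →ₗ⁅ℝ⁆ G6 where
  toFun x := mk ![s₁ * coord 0 x + ε₁ * α * coord 4 x, ε₁ * s₁ * coord 1 x + ε₁ * β * coord 4 x,
    s₂ * coord 2 x + ε₂ * γ * coord 5 x, ε₂ * s₂ * coord 3 x + ε₂ * δ * coord 5 x,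
    ε₁ * coord 4 x, ε₂ * coord 5 x]
  map_add' x y := by apply ext_coord <;> simp <;> ring
  map_smul' c x := by apply ext_coord <;> simp <;> ring
  map_lie' {x y} := by
    apply ext_coord <;> simp [coord_lie]
    · linear_combination (-s₁ * (coord 4 x * coord 1 y - coord 1 x * coord 4 y)) * h₁
    · ring
    · linear_combination (-s₂ * (coord 5 x * coord 3 y - coord 3 x * coord 5 y)) * h₂
    · ring

/-- The automorphism of `𝔤_(1,0,0,1)` that exchanges the two rotation planes. -/
noncomputable def swapHom : G6 →ₗ⁅ℝ⁆ G6 where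
  toFun x := mk ![coord 2 x, coord 3 x, coord 0 x, coord 1 x, coord 5 x, coord 4 x]
  map_add' x y := by apply ext_coord <;> simp
  map_smul' c x := by apply ext_coord <;> simp
  map_lie' {x y} := by apply ext_coord <;> simp [coord_lie]

theorem _root_.exists_sign_mul_sq_eq_one {a : ℝ} (ha : a ≠ 0) :
    ∃ ε s : ℝ, ε * ε = 1 ∧ a * (ε * (s * s)) = 1 := by
  rcases lt_or_gt_of_ne ha with h | h
  · refine ⟨-1, (√(-a))⁻¹, by norm_num, ?_⟩
    rw [← mul_inv, Real.mul_self_sqrt (by linarith)]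
    field_simp
  · refine ⟨1, (√a)⁻¹, by norm_num, ?_⟩
    rw [← mul_inv, Real.mul_self_sqrt h.le]
    field_simp

/-- Every symplectic form on `𝔤_(1,0,0,1)` is equivalent to `e^{12} + e^{34} + η e^{56}`, `η > 0`. -/
theorem exists_normal_form {ω : G6 →ₗ[ℝ] G6 →ₗ[ℝ] ℝ} (hω : IsSymplecticForm ω) :
    ∃ (η : ℝ) (φ : G6 →ₗ⁅ℝ⁆ G6), 0 < η ∧ ∀ x y, ω (φ x) (φ y) =
      (coord 0 x * coord 1 y - coord 1 x * coord 0 y)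
      + (coord 2 x * coord 3 y - coord 3 x * coord 2 y)
      + η * (coord 4 x * coord 5 y - coord 5 x * coord 4 y) := by
  obtain ⟨a, b, c, p, q, r, s, h⟩ := closed_form_apply hω
  have hnd : ∀ z, (∀ y, ω z y = 0) → z = 0 := hω.nondegenerate.1
  have ha : a ≠ 0 := by
    rintro rfl
    -- For a = 0 this vector lies in the radical, so p = q = 0, and then `e 0` lies there as well.
    have h1 := hnd (q • e 0 - p • e 1) fun y => by
      rw [h]
      simp [coord_e]
      ring
    have hq : q = 0 := by simpa [coord_e] using congrArg (coord 0) h1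
    have hp : p = 0 := by simpa [coord_e] using congrArg (coord 1) h1
    have h2 := hnd (e 0) fun y => by
      rw [h]
      simp [coord_e, hp]
    simpa [coord_e] using congrArg (coord 0) h2
  have hb : b ≠ 0 := by
    rintro rfl
    have h1 := hnd (s • e 2 - r • e 3) fun y => by
      rw [h]
      simp [coord_e]
      ring
    have hs : s = 0 := by simpa [coord_e] using congrArg (coord 2) h1
    have hr : r = 0 := by simpa [coord_e] using congrArg (coord 3) h1
    have h2 := hnd (e 2) fun y => by
      rw [h]
      simp [coord_e, hr]
    simpa [coord_e] using congrArg (coord 2) h2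
  have hc : c ≠ 0 := by
    rintro rfl
    have h1 := hnd (e 4 + (q / a) • e 0 - (p / a) • e 1) fun y => by
      rw [h]
      simp [coord_e]
      field_simp
      ring
    simpa [coord_e] using congrArg (coord 4) h1
  obtain ⟨ε₁, s₁, h₁, k₁⟩ := exists_sign_mul_sq_eq_one ha
  obtain ⟨ε₂, s₂, h₂, k₂⟩ := exists_sign_mul_sq_eq_one hb
  -- The translations make the images of `e 4` and `e 5` orthogonal to the rotation planes; the
  -- signs and scales normalise a and b to 1.
  have hφ := fun x y => h (planeHom s₁ s₂ ε₁ ε₂ (q / a) (-p / a) (s / b) (-r / b) h₁ h₂ x)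
    (planeHom s₁ s₂ ε₁ ε₂ (q / a) (-p / a) (s / b) (-r / b) h₁ h₂ y)
  set φ := planeHom s₁ s₂ ε₁ ε₂ (q / a) (-p / a) (s / b) (-r / b) h₁ h₂ with hdef
  have hφ' : ∀ x y, ω (φ x) (φ y) =
      (coord 0 x * coord 1 y - coord 1 x * coord 0 y)
      + (coord 2 x * coord 3 y - coord 3 x * coord 2 y)
      + (c * ε₁ * ε₂) * (coord 4 x * coord 5 y - coord 5 x * coord 4 y) := by
    intro x y
    have hc0 : ∀ x, coord 0 (φ x) = s₁ * coord 0 x + ε₁ * (q / a) * coord 4 x := fun _ => rfl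
    have hc1 : ∀ x, coord 1 (φ x) = ε₁ * s₁ * coord 1 x + ε₁ * (-p / a) * coord 4 x := fun _ => rfl
    have hc2 : ∀ x, coord 2 (φ x) = s₂ * coord 2 x + ε₂ * (s / b) * coord 5 x := fun _ => rfl
    have hc3 : ∀ x, coord 3 (φ x) = ε₂ * s₂ * coord 3 x + ε₂ * (-r / b) * coord 5 x := fun _ => rfl
    have hc4 : ∀ x, coord 4 (φ x) = ε₁ * coord 4 x := fun _ => rfl
    have hc5 : ∀ x, coord 5 (φ x) = ε₂ * coord 5 x := fun _ => rfl
    rw [hφ, ← one_mul (coord 0 x * coord 1 y - _), ← one_mul (coord 2 x * coord 3 y - _)]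
    nth_rewrite 2 [← k₂]
    rw [← k₁]
    simp only [hc0, hc1, hc2, hc3, hc4, hc5]
    field_simp
    ring
  have hε : c * ε₁ * ε₂ ≠ 0 :=
    mul_ne_zero (mul_ne_zero hc (left_ne_zero_of_mul_eq_one h₁)) (left_ne_zero_of_mul_eq_one h₂)
  rcases lt_or_gt_of_ne hε with hη | hη
  -- Exchanging the planes also exchanges e₅ and e₆, which reverses the sign of η and preserves the
  -- rest of the form.
  · refine ⟨-(c * ε₁ * ε₂), φ.comp swapHom, by linarith, fun x y => ?_⟩
    rw [LieHom.comp_apply, LieHom.comp_apply, hφ']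
    simp only [swapHom, LieHom.coe_mk, coord_mk]
    simp
    ring
  · exact ⟨_, φ, hη, hφ'⟩

/-- The pulled-back form is non-degenerate, so φ is injective; equality of dimensions gives
surjectivity. -/
theorem bijective_of_normal_form {ω : G6 →ₗ[ℝ] G6 →ₗ[ℝ] ℝ} {η : ℝ} (hη : η ≠ 0)
    {φ : G6 →ₗ⁅ℝ⁆ G6} (hφ : ∀ x y, ω (φ x) (φ y) =
      (coord 0 x * coord 1 y - coord 1 x * coord 0 y)
      + (coord 2 x * coord 3 y - coord 3 x * coord 2 y)
      + η * (coord 4 x * coord 5 y - coord 5 x * coord 4 y)) : Function.Bijective φ := by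
  have : FiniteDimensional ℝ G6 := inferInstanceAs (FiniteDimensional ℝ (Fin 6 → ℝ))
  have hinj : Function.Injective (φ : G6 →ₗ[ℝ] G6) := by
    rw [← LinearMap.ker_eq_bot, LinearMap.ker_eq_bot']
    intro x hx
    replace hx : φ x = 0 := hx
    have h : ∀ i, ω (φ x) (φ (e i)) = 0 := fun i => by rw [hx, map_zero, LinearMap.zero_apply]
    have h0 := h 0
    have h1 := h 1
    have h2 := h 2
    have h3 := h 3
    have h4 := h 4
    have h5 := h 5
    rw [hφ] at h0 h1 h2 h3 h4 h5
    simp [coord_e, hη] at h0 h1 h2 h3 h4 h5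
    apply ext_coord <;> simpa
  exact ⟨hinj, LinearMap.injective_iff_surjective.1 hinj⟩

end G6

/-! ### Coordinates on the eight-dimensional models -/

namespace G8

variable {a b : ℝ}

/-- The coordinates on the eight-dimensional Lie algebra. -/
noncomputable def coord (i : Fin 8) : G8 a b →ₗ[ℝ] ℝ := (LinearMap.proj i : (Fin 8 → ℝ) →ₗ[ℝ] ℝ)

/-- The element of the eight-dimensional Lie algebra with given coordinates. -/
noncomputable def mk (x : Fin 8 → ℝ) : G8 a b := x

theorem ext_coord {x y : G8 a b} (h : ∀ i, coord i x = coord i y) : x = y := funext h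

theorem _root_.bracketG8_apply (a b : ℝ) (x y : Fin 8 → ℝ) :
    bracketG8 a b x y 0 = -(x 1 * y 4 - y 1 * x 4) ∧ bracketG8 a b x y 1 = x 0 * y 4 - y 0 * x 4 ∧
    bracketG8 a b x y 2 = -(x 3 * y 5 - y 3 * x 5) ∧ bracketG8 a b x y 3 = x 2 * y 5 - y 2 * x 5 ∧
    bracketG8 a b x y 4 = 0 ∧ bracketG8 a b x y 5 = 0 ∧
    bracketG8 a b x y 6 = y 6 * (a * x 4 + b * x 5) - x 6 * (a * y 4 + b * y 5) ∧
    bracketG8 a b x y 7 = x 7 * (a * y 4 + b * y 5) - y 7 * (a * x 4 + b * x 5) := by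
  refine ⟨?_, ?_, ?_, ?_, ?_, ?_, ?_, ?_⟩ <;> simp [bracketG8, wedgeForm_apply, stdVec] <;> ring

theorem coord_lie (x y : G8 a b) :
    coord 0 ⁅x, y⁆ = -(coord 1 x * coord 4 y - coord 1 y * coord 4 x) ∧
    coord 1 ⁅x, y⁆ = coord 0 x * coord 4 y - coord 0 y * coord 4 x ∧
    coord 2 ⁅x, y⁆ = -(coord 3 x * coord 5 y - coord 3 y * coord 5 x) ∧
    coord 3 ⁅x, y⁆ = coord 2 x * coord 5 y - coord 2 y * coord 5 x ∧
    coord 4 ⁅x, y⁆ = 0 ∧ coord 5 ⁅x, y⁆ = 0 ∧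
    coord 6 ⁅x, y⁆ = coord 6 y * (a * coord 4 x + b * coord 5 x)
      - coord 6 x * (a * coord 4 y + b * coord 5 y) ∧
    coord 7 ⁅x, y⁆ = coord 7 x * (a * coord 4 y + b * coord 5 y)
      - coord 7 y * (a * coord 4 x + b * coord 5 x) :=
  bracketG8_apply a b x y

theorem _root_.wedgeForm_sum_apply (η : ℝ) (x y : Fin 8 → ℝ) :
    (wedgeForm 0 1 + wedgeForm 2 3 + η • wedgeForm 4 5 + wedgeForm 6 7 :
      (Fin 8 → ℝ) →ₗ[ℝ] (Fin 8 → ℝ) →ₗ[ℝ] ℝ) x y =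
    (x 0 * y 1 - y 0 * x 1) + (x 2 * y 3 - y 2 * x 3) + η * (x 4 * y 5 - y 4 * x 5)
    + (x 6 * y 7 - y 6 * x 7) := by
  simp only [LinearMap.add_apply, LinearMap.smul_apply, wedgeForm_apply, smul_eq_mul]
  ring

theorem formG8_apply (η : ℝ) (x y : G8 a b) : formG8 a b η x y =
    (coord 0 x * coord 1 y - coord 0 y * coord 1 x)
    + (coord 2 x * coord 3 y - coord 2 y * coord 3 x)
    + η * (coord 4 x * coord 5 y - coord 4 y * coord 5 x)
    + (coord 6 x * coord 7 y - coord 6 y * coord 7 x) :=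
  wedgeForm_sum_apply η x y

/-- The projection to the first six coordinates. -/
noncomputable def proj6 : G8 a b →ₗ[ℝ] G6 where
  toFun x := G6.mk ![coord 0 x, coord 1 x, coord 2 x, coord 3 x, coord 4 x, coord 5 x]
  map_add' x y := by apply G6.ext_coord <;> simp
  map_smul' c x := by apply G6.ext_coord <;> simp

theorem coord_proj6 (x : G8 a b) :
    G6.coord 0 (proj6 x) = coord 0 x ∧ G6.coord 1 (proj6 x) = coord 1 x ∧
    G6.coord 2 (proj6 x) = coord 2 x ∧ G6.coord 3 (proj6 x) = coord 3 x ∧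
    G6.coord 4 (proj6 x) = coord 4 x ∧ G6.coord 5 (proj6 x) = coord 5 x :=
  ⟨rfl, rfl, rfl, rfl, rfl, rfl⟩

theorem proj6_lie (x y : G8 a b) : proj6 ⁅x, y⁆ = ⁅proj6 x, proj6 y⁆ := by
  apply G6.ext_coord <;> simp [coord_proj6, coord_lie, G6.coord_lie]

end G8

/-! ### Identification with the models and conclusion -/

open G8 in
/-- A reduced oxidation of a normalised form is symplectomorphic to a member of the families. -/
theorem GeneralizedSymplecticOxidation.symplectomorphic_formG8 {𝔤 : Type*} [LieRing 𝔤]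
    [LieAlgebra ℝ 𝔤] {ω : 𝔤 →ₗ[ℝ] 𝔤 →ₗ[ℝ] ℝ} (hω : ∀ x, ω x x = 0) {ω' : G6 →ₗ[ℝ] G6 →ₗ[ℝ] ℝ}
    (O : GeneralizedSymplecticOxidation ω ω') (hD : O.D = 0) (ht : O.t = 0) (hlam : O.lam = 0)
    {η a b : ℝ} {φ : G6 →ₗ⁅ℝ⁆ G6} (hbij : Function.Bijective φ)
    (hφ : ∀ x y, ω' (φ x) (φ y) =
      (G6.coord 0 x * G6.coord 1 y - G6.coord 1 x * G6.coord 0 y)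
      + (G6.coord 2 x * G6.coord 3 y - G6.coord 3 x * G6.coord 2 y)
      + η * (G6.coord 4 x * G6.coord 5 y - G6.coord 5 x * G6.coord 4 y))
    (hμ : ∀ x, O.μ (φ x) = a * G6.coord 4 x + b * G6.coord 5 x) :
    Symplectomorphic ω (formG8 a b η) := by
  have hskew : ∀ x y, ω x y = -ω y x := skew_of_alt hω
  have hιξ : ∀ x, ω (O.ι x) O.ξ = 0 := fun x => by rw [hskew, O.form_ξ_ι, neg_zero]
  have hιℓ : ∀ x, ω (O.ι x) O.ℓ = 0 := fun x => by rw [hskew, O.form_ℓ_ι, neg_zero]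
  have hξℓ : ω O.ξ O.ℓ = -1 := by rw [hskew, O.form_ℓ_ξ]
  -- Here e₇ goes to ξ and e₈ to -ℓ; the sign matches ω(ξ, ℓ) = -1 with the term e⁷⁸.
  let Ψ : G8 a b →ₗ⁅ℝ⁆ 𝔤 :=
    { O.ι ∘ₗ (φ : G6 →ₗ[ℝ] G6) ∘ₗ proj6 + (coord 6).smulRight O.ξ - (coord 7).smulRight O.ℓ with
      map_lie' := by
        intro x y
        change O.ι (φ (proj6 ⁅x, y⁆)) + coord 6 ⁅x, y⁆ • O.ξ - coord 7 ⁅x, y⁆ • O.ℓ =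
          ⁅O.ι (φ (proj6 x)) + coord 6 x • O.ξ - coord 7 x • O.ℓ,
            O.ι (φ (proj6 y)) + coord 6 y • O.ξ - coord 7 y • O.ℓ⁆
        simp only [proj6_lie, LieHom.map_lie, lie_add, lie_sub, add_lie, sub_lie, lie_smul,
          smul_lie, O.lie_ι_ι, O.lie_ξ_ι, O.lie_ι_ξ, O.lie_ℓ_ι, O.lie_ι_ℓ, O.lie_ξ_ℓ, O.lie_ℓ_ξ,
          lie_self, hD, ht, hlam, hμ, LinearMap.zero_apply, map_zero, coord_lie, coord_proj6]
        module }
  have hΨ : ∀ x, Ψ x = O.ι (φ (proj6 x)) + coord 6 x • O.ξ - coord 7 x • O.ℓ := fun _ => rfl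
  have hΨbij : Function.Bijective Ψ := by
    constructor
    · intro x y hxy
      rw [hΨ, hΨ] at hxy
      obtain ⟨h7, h, h6⟩ := O.components_eq (a := -coord 7 x) (a' := -coord 7 y)
        (b := coord 6 x) (b' := coord 6 y) (x := φ (proj6 x)) (x' := φ (proj6 y))
        (by linear_combination (norm := module) hxy)
      have h' := hbij.1 h
      refine ext_coord fun i => ?_
      fin_cases i
      exacts [congrArg (G6.coord 0) h', congrArg (G6.coord 1) h', congrArg (G6.coord 2) h',
        congrArg (G6.coord 3) h', congrArg (G6.coord 4) h', congrArg (G6.coord 5) h', h6,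
        neg_injective h7]
    · intro z
      obtain ⟨⟨r, x, s⟩, rfl⟩ := O.decomposition.surjective z
      obtain ⟨y, rfl⟩ := hbij.2 x
      let w : G8 a b := G8.mk ![G6.coord 0 y, G6.coord 1 y, G6.coord 2 y,
        G6.coord 3 y, G6.coord 4 y, G6.coord 5 y, s, -r]
      have hy : proj6 w = y := by apply G6.ext_coord <;> rfl
      have h6 : coord 6 w = s := rfl
      have h7 : coord 7 w = -r := rfl
      refine ⟨w, ?_⟩
      rw [hΨ, hy, h6, h7]
      module
  have hform : ∀ x y, ω (Ψ x) (Ψ y) = formG8 a b η x y := by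
    intro x y
    simp only [hΨ, map_add, map_sub, map_smul, LinearMap.add_apply, LinearMap.sub_apply,
      LinearMap.smul_apply, O.form_ι, hφ, hιξ, hιℓ, hξℓ, O.form_ℓ_ι, O.form_ξ_ι, O.form_ℓ_ξ, hω,
      formG8_apply, coord_proj6, smul_eq_mul]
    ring
  let E : G8 a b ≃ₗ⁅ℝ⁆ 𝔤 := LieEquiv.ofBijective Ψ hΨbij
  refine ⟨E.symm, fun x y => ?_⟩
  rw [← hform]
  exact congrArg₂ (fun u v => ω u v) (E.apply_symm_apply x) (E.apply_symm_apply y)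

theorem mainTheorem8 {𝔤 : Type*} [LieRing 𝔤] [LieAlgebra ℝ 𝔤]
    (ω : 𝔤 →ₗ[ℝ] 𝔤 →ₗ[ℝ] ℝ) (hω : IsSymplecticForm ω)
    (ω' : G6 →ₗ[ℝ] G6 →ₗ[ℝ] ℝ) (hω' : IsSymplecticForm ω')
    (O : GeneralizedSymplecticOxidation ω ω')
    (hcentral : ¬ O.IsCentral) (hnormal : ¬ O.IsNormal) :
    (∃ η μ₁ μ₂ : ℝ, 0 < η ∧ μ₁ ≠ 0 ∧ μ₂ ≠ 0 ∧ Symplectomorphic ω (formG8 μ₁ μ₂ η)) ∨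
    (∃ η μ : ℝ, 0 < η ∧ μ ≠ 0 ∧ Symplectomorphic ω (formG8 μ 0 η)) ∨
    (∃ η μ : ℝ, 0 < η ∧ μ ≠ 0 ∧ Symplectomorphic ω (formG8 0 μ η)) := by
  obtain ⟨p, q, hpq⟩ := G6.exists_eq_one O.μ_lie (O.exists_μ_ne_zero hω.alt hnormal)
  obtain ⟨v, hv⟩ := G6.cocycle_eq_coboundary hpq O.μ_lie fun x y => (O.leibniz_components x y).1
  obtain ⟨O₁, hμ₁, hD₁, ht₁⟩ := O.exists_D_eq_zero hω.alt hω' hpq hv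
  obtain ⟨s, hs⟩ := G6.scalar_cocycle_eq_smul (μ := O₁.μ) (by rw [hμ₁, hpq]) O₁.μ_lie
    fun x y => by simpa [hD₁] using (O₁.leibniz_components x y).2
  obtain ⟨O₂, hμ₂, hD₂, ht₂, hlam₂⟩ := O₁.exists_lam_eq_zero hω.alt hD₁ ht₁ hs
  obtain ⟨η, φ, hη, hφ⟩ := G6.exists_normal_form hω'
  have hbij := G6.bijective_of_normal_form hη.ne' hφ
  have hμφ : ∀ x, O₂.μ (φ x) =
      O₂.μ (φ (G6.e 4)) * G6.coord 4 x + O₂.μ (φ (G6.e 5)) * G6.coord 5 x := fun x =>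
    G6.form_apply_of_lie_eq_zero (f := O₂.μ ∘ₗ (φ : G6 →ₗ[ℝ] G6))
      (fun x y => by simp [O₂.μ_lie]) x
  have key := O₂.symplectomorphic_formG8 hω.alt hD₂ ht₂ hlam₂ hbij hφ hμφ
  by_cases h4 : O₂.μ (φ (G6.e 4)) = 0
  · by_cases h5 : O₂.μ (φ (G6.e 5)) = 0
    -- If both coefficients vanished, μ ∘ φ would be zero, contradicting μ(x₀) = 1 because φ is
    -- onto.
    · obtain ⟨x, hx⟩ := hbij.2 (p • G6.e 4 + q • G6.e 5)
      have := hμφ x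
      rw [hx, hμ₂, hμ₁, hpq, ← hμ₁, ← hμ₂, h4, h5] at this
      simp at this
    · exact Or.inr (Or.inr ⟨η, _, hη, h5, h4 ▸ key⟩)
  · by_cases h5 : O₂.μ (φ (G6.e 5)) = 0
    · exact Or.inr (Or.inl ⟨η, _, hη, h4, h5 ▸ key⟩)
    · exact Or.inl ⟨η, _, _, hη, h4, h5, key⟩
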